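/- Let $f_X,f_Y:\mathbb R^d\to[0,\infty)$ be spectral densities, i.e. functions integrable with respect to $(1\wedge|\xi|^2)\,d\xi$, and let $X=\{X(x)\}_{x\in\mathbb R^d}$ and $Y=\{Y(x)\}_{x\in\mathbb R^d}$ be real-valued Gaussian fields with stationary increments having these spectral densities; that is, $X$ has the law of $\int_{\mathbb R^d}(e^{i x\cdot\xi}-1)f_X^{1/2}(\xi)\,d\widehat W(\xi)$, meaning that $X$ is a centered Gaussian field with $$\mathbb E[X(x)X(x')]=\int_{\mathbb R^d}(e^{i x\cdot\xi}-1)(e^{-i x'\cdot\xi}-1)f_X(\xi)\,d\xi\qquad(x,x'\in\mathbb R^d),$$ and likewise for $Y$ and $f_Y$. Let $K\subset\mathbb R^d$ be compact, and let $B$ be a separable Banach space, or a normed space that is the dual of a separable normed space, continuously embedded in $C^0(K)$. We say that the sample paths of a field $Z$ belong a.s. to $B$ if there is a Borel set $S$ of $C^0(K)$, contained in $B$, such that almost surely the restriction to $K$ of the path of $Z$ belongs to $S$ (if $B$ is a Borel subset of $C^0(K)$, as it is when $B$ is a separable Banach space, one can take $S=B$). Assume that for some $C>0$ one has $f_X(\xi)\le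 C f_Y(\xi)$ for all $\xi\in\mathbb R^d$. If $Y$ has a version whose sample paths belong a.s. to $B$, then $X$ has a version whose sample paths belong a.s. to $B$; moreover, the sample paths of every version of $X$ that is a.s. continuous on $K$ belong a.s. to $B$. -/

import Mathlib

open MeasureTheory ProbabilityTheory

/-- A spectral density on `ℝ^d`: a nonnegative function, integrable with respect to the measure
`(1 ∧ |ξ|²) dξ`. -/
structure IsSpectralDensity {d : ℕ} (f : EuclideanSpace ℝ (Fin d) → ℝ) : Prop where
  nonneg : ∀ ξ, 0 ≤ f ξ
  integrable : Integrable (fun ξ => min 1 (‖ξ‖ ^ 2) * f ξ)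

/-- The function `e^{i x·ξ} - 1` of `ξ`. -/
noncomputable def incrementKernel {d : ℕ} (x ξ : EuclideanSpace ℝ (Fin d)) : ℂ :=
  Complex.exp (Complex.I * (inner ℝ x ξ : ℝ)) - 1

/-- `X` is a real-valued random field on `(Ω, P)` with the law of the stochastic integral
`X(x) = ∫ (e^{i x·ξ} - 1) f(ξ)^{1/2} dŴ(ξ)`: a centered Gaussian field with covariance
`E[X(x) X(x')] = ∫ (e^{i x·ξ} - 1) (e^{-i x'·ξ} - 1) f(ξ) dξ`. The equality of complex numbers says
also that the right-hand side is real, as it is for even `f`. -/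
structure IsGaussianFieldWithSpectralDensity {d : ℕ} {Ω : Type*} [MeasurableSpace Ω]
    (X : EuclideanSpace ℝ (Fin d) → Ω → ℝ) (P : Measure Ω)
    (f : EuclideanSpace ℝ (Fin d) → ℝ) : Prop where
  density : IsSpectralDensity f
  gaussian : IsGaussianProcess X P
  centered : ∀ x, ∫ ω, X x ω ∂P = 0
  covariance : ∀ x x', ((∫ ω, X x ω * X x' ω ∂P : ℝ) : ℂ) =
    ∫ ξ, incrementKernel x ξ * (starRingEnd ℂ) (incrementKernel x' ξ) * (f ξ : ℂ)

/-- `X'` is a version (modification) of `X`. -/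
def IsVersionOf {T Ω : Type*} [MeasurableSpace Ω] (P : Measure Ω) (X' X : T → Ω → ℝ) : Prop :=
  ∀ t, X' t =ᵐ[P] X t

/-- The normed space `B` is, up to an isomorphism of normed spaces, the dual of a separable
normed space. -/
def IsDualOfSeparable.{u} (B : Type u) [NormedAddCommGroup B] [NormedSpace ℝ B] : Prop :=
  ∃ (E : Type u) (_ : NormedAddCommGroup E) (_ : NormedSpace ℝ E),
    TopologicalSpace.SeparableSpace E ∧ Nonempty (B ≃L[ℝ] StrongDual ℝ E)

/-- The sample paths of `Z`, restricted to `K`, belong almost surely to the subset `A` of `C⁰(K)`.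
As `A` need not be a Borel subset of `C⁰(K)`, this is read, as usual for a random element of
`C⁰(K)`, as an almost sure event `Z ∈ S` for a Borel set `S ⊆ A`. -/
def SamplePathsIn {T Ω : Type*} [TopologicalSpace T] [MeasurableSpace Ω] (P : Measure Ω)
    (Z : T → Ω → ℝ) (K : Set T) (A : Set C(K, ℝ)) : Prop :=
  ∃ S : Set C(K, ℝ), MeasurableSet[borel C(K, ℝ)] S ∧ S ⊆ A ∧
    ∀ᵐ ω ∂P, ∃ g ∈ S, ∀ x : K, Z x ω = g x

/-- For a separable Banach space `B` continuously embedded in `C⁰(K)`, and more generally whenever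
`B` is a Borel subset of `C⁰(K)`, `SamplePathsIn` says just that almost every path is in `B`. -/
theorem samplePathsIn_range_iff {T Ω : Type*} [TopologicalSpace T] [MeasurableSpace Ω]
    (P : Measure Ω) (Z : T → Ω → ℝ) {K : Set T} (hK : IsCompact K)
    {B : Type*} [NormedAddCommGroup B] [NormedSpace ℝ B]
    (ι : B →L[ℝ] C(K, ℝ)) (hι : Function.Injective ι)
    (h : (CompleteSpace B ∧ TopologicalSpace.SeparableSpace B) ∨
      MeasurableSet[borel C(K, ℝ)] (Set.range ι)) :
    SamplePathsIn P Z K (Set.range ι) ↔ ∀ᵐ ω ∂P, ∃ b : B, ∀ x : K, Z x ω = ι b x := by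
  have hr : MeasurableSet[borel C(K, ℝ)] (Set.range ι) := by
    rcases h with ⟨h1, h2⟩ | h
    · have : SecondCountableTopology B := UniformSpace.secondCountable_of_separable B
      have : CompactSpace K := isCompact_iff_compactSpace.mp hK
      borelize B C(K, ℝ)
      exact MeasureTheory.measurableSet_range_of_continuous_injective ι.continuous hι
    · exact h
  constructor
  · rintro ⟨S, -, hS, hZ⟩
    filter_upwards [hZ] with ω ⟨g, hg, hx⟩
    obtain ⟨b, rfl⟩ := hS hg
    exact ⟨b, hx⟩
  · intro hZ
    refine ⟨_, hr, subset_rfl, ?_⟩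
    filter_upwards [hZ] with ω ⟨b, hb⟩
    exact ⟨ι b, ⟨b, rfl⟩, hb⟩

/-! ### Laws and construction of Gaussian sequences. -/

open scoped RealInnerProductSpace

/-! Since `C * fY - fX` is again a spectral density, there is a centered Gaussian `Z`, independent
of `X`, such that `X + Z` and `X - Z` both have the law of `√C Y` (`exists_map_add_eq`). Hence
almost surely both paths lie in the range of `ι`, and so does their half-difference `Z`. By Fubini,
one value of `Z` can be frozen; then `X = (X + Z) - Z` lies in that range almost surely
(`exists_ae_mem_of_map_add_eq`). Laws are compared only along a dense sequence of `K`. This suffices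
because evaluation there is injective on `C(K, ℝ)` and sends Borel sets to measurable subsets of
`ℝ^ℕ` (`measurableSet_image_eval_denseRange`). Adjoining arbitrary points to the sequence then
yields a version on all of `K`. -/

theorem ProbabilityTheory.IsGaussianProcess.map_eq_of_covariance_eq {T Ω Ω' : Type*} [Countable T]
    [MeasurableSpace Ω] [MeasurableSpace Ω'] {P : Measure Ω} {P' : Measure Ω'}
    [IsProbabilityMeasure P] [IsProbabilityMeasure P']
    {X : T → Ω → ℝ} {Y : T → Ω' → ℝ} (hX : IsGaussianProcess X P) (hY : IsGaussianProcess Y P')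
    (hmean : ∀ t, ∫ ω, X t ω ∂P = ∫ ω, Y t ω ∂P')
    (hcov : ∀ s t, cov[X s, X t; P] = cov[Y s, Y t; P']) :
    P.map (fun ω t => X t ω) = P'.map (fun ω t => Y t ω) := by
  have mX : AEMeasurable (fun ω t => X t ω) P := aemeasurable_pi_lambda _ hX.aemeasurable
  have mY : AEMeasurable (fun ω t => Y t ω) P' := aemeasurable_pi_lambda _ hY.aemeasurable
  have hlim := isProjectiveLimit_map mY
  -- The characteristic function of a Gaussian vector at `L` depends only on the mean and variance
  -- of its image under `L`, and these are determined by means and covariances.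
  have key : ∀ I : Finset T, P.map (fun ω => I.restrict (X · ω)) =
      P'.map (fun ω => I.restrict (Y · ω)) := by
    intro I
    classical
    have gX := hX.hasGaussianLaw I
    have gY := hY.hasGaussianLaw I
    have := gX.isGaussian_map
    have := gY.isGaussian_map
    refine Measure.ext_of_charFunDual ?_
    ext L
    have hL : ∀ x : I → ℝ, L x = ∑ i : I, L (Pi.single i 1) * x i := by
      intro x
      conv_lhs => rw [← L.sum_comp_single]
      refine Finset.sum_congr rfl fun i _ => ?_
      have : (Pi.single i (x i) : I → ℝ) = x i • Pi.single i 1 := by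
        rw [← Pi.single_smul]; simp
      simp only [ContinuousLinearMap.comp_apply, ContinuousLinearMap.single_apply]
      rw [this, map_smul, smul_eq_mul, mul_comm]
    have m2X : ∀ i : I, MemLp (fun ω => L (Pi.single i 1) * X i ω) 2 P :=
      fun i => (hX.hasGaussianLaw_eval i).memLp_two.const_mul _
    have m2Y : ∀ i : I, MemLp (fun ω => L (Pi.single i 1) * Y i ω) 2 P' :=
      fun i => (hY.hasGaussianLaw_eval i).memLp_two.const_mul _
    rw [gX.charFunDual_map_eq_fun, gY.charFunDual_map_eq_fun]
    have hLX : ∀ ω, L (I.restrict (X · ω)) = ∑ i : I, L (Pi.single i 1) * X i ω := fun ω => hL _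
    have hLY : ∀ ω, L (I.restrict (Y · ω)) = ∑ i : I, L (Pi.single i 1) * Y i ω := fun ω => hL _
    simp only [hLX, hLY]
    have h1 : ∫ ω, ∑ i : I, L (Pi.single i 1) * X i ω ∂P =
        ∫ ω, ∑ i : I, L (Pi.single i 1) * Y i ω ∂P' := by
      rw [integral_finsetSum _ fun i _ => (m2X i).integrable one_le_two,
        integral_finsetSum _ fun i _ => (m2Y i).integrable one_le_two]
      simp only [integral_const_mul, hmean]
    have h2 : Var[fun ω => ∑ i : I, L (Pi.single i 1) * X i ω; P] =
        Var[fun ω => ∑ i : I, L (Pi.single i 1) * Y i ω; P'] := by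
      rw [← covariance_self
          (Finset.aemeasurable_fun_sum _ fun i _ => (m2X i).aestronglyMeasurable.aemeasurable),
        ← covariance_self
          (Finset.aemeasurable_fun_sum _ fun i _ => (m2Y i).aestronglyMeasurable.aemeasurable),
        covariance_fun_sum_fun_sum m2X m2X, covariance_fun_sum_fun_sum m2Y m2Y]
      simp only [covariance_const_mul_left, covariance_const_mul_right, hcov]
    rw [h1, h2]
  have := Measure.isProbabilityMeasure_map mX
  have := Measure.isProbabilityMeasure_map mY
  have hlimX := isProjectiveLimit_map mX
  simp_rw [key] at hlimX
  exact hlimX.unique hlim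

/-- Expand each `φ n` in the orthogonal Gram–Schmidt vectors `g i`, then replace `g i` by `‖g i‖ * N
i` with `N` i.i.d. standard normal. A vanishing `g i` is harmless, as its weight is zero. -/
theorem exists_isGaussianProcess_covariance_eq_inner {H : Type*} [NormedAddCommGroup H]
    [InnerProductSpace ℝ H] (φ : ℕ → H) :
    ∃ (Ω : Type) (_ : MeasurableSpace Ω) (P : Measure Ω) (_ : IsProbabilityMeasure P)
      (Z : ℕ → Ω → ℝ), (∀ n, Measurable (Z n)) ∧ IsGaussianProcess Z P ∧
      (∀ n, ∫ ω, Z n ω ∂P = 0) ∧ ∀ n m, cov[Z n, Z m; P] = ⟪φ n, φ m⟫ := by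
  obtain ⟨Ω, mΩ, P, N, hN, hlaw, hind, hP⟩ := exists_iid ℕ (gaussianReal 0 1)
  let g := InnerProductSpace.gramSchmidt ℝ φ
  have hspan : ∀ n, ∃ c : ℕ →₀ ℝ, (c.sum fun i a => a • g i) = φ n := fun n => by
    rw [← Finsupp.mem_span_range_iff_exists_finsupp]
    change φ n ∈ Submodule.span ℝ (Set.range (InnerProductSpace.gramSchmidt ℝ φ))
    rw [InnerProductSpace.span_gramSchmidt]
    exact Submodule.subset_span ⟨n, rfl⟩
  choose c hc using hspan
  have gN : IsGaussianProcess N P := by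
    refine ⟨fun I => iIndepFun.hasGaussianLaw (X := fun i : I => N i)
      (fun i => (hlaw i).hasGaussianLaw) (hind.precomp Subtype.val_injective)⟩
  have mN : ∀ i, MemLp (N i) 2 P := fun i => (gN.hasGaussianLaw_eval i).memLp_two
  have meanN : ∀ i, ∫ ω, N i ω ∂P = 0 := fun i => by
    rw [(hlaw i).integral_eq, integral_id_gaussianReal]
  have covN : ∀ i j, ‖g i‖ * (‖g j‖ * cov[N i, N j; P]) = ⟪g i, g j⟫ := by
    intro i j
    rcases eq_or_ne i j with rfl | hij
    · rw [covariance_self (hN i).aemeasurable, (hlaw i).variance_eq, variance_id_gaussianReal,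
        real_inner_self_eq_norm_sq]
      simp [sq]
    · rw [(hind.indepFun hij).covariance_eq_zero (mN i) (mN j)]
      simp [g, InnerProductSpace.gramSchmidt_orthogonal ℝ φ hij]
  refine ⟨Ω, mΩ, P, hP, fun n ω => ∑ i ∈ (c n).support, c n i * (‖g i‖ * N i ω), ?_, ?_, ?_, ?_⟩
  · intro n; fun_prop
  · refine gN.of_isGaussianProcess fun n => ⟨(c n).support,
      ∑ i : (c n).support, (c n i * ‖g i‖) • ContinuousLinearMap.proj i, fun ω => ?_⟩
    simp only [sum_apply, smul_apply,
      ContinuousLinearMap.proj_apply, Finset.restrict, smul_eq_mul, mul_assoc]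
    exact (Finset.sum_coe_sort (c n).support fun i => c n i * (‖g i‖ * N i ω)).symm
  · intro n
    rw [integral_finsetSum _ fun i _ =>
      (((mN i).integrable one_le_two).const_mul _).const_mul _]
    simp [integral_const_mul, meanN]
  · intro n m
    rw [covariance_fun_sum_fun_sum' (fun i _ => ((mN i).const_mul _).const_mul _)
      (fun i _ => ((mN i).const_mul _).const_mul _), ← hc n, ← hc m, Finsupp.sum, Finsupp.sum,
      sum_inner]
    refine Finset.sum_congr rfl fun i _ => ?_
    rw [inner_sum]
    refine Finset.sum_congr rfl fun j _ => ?_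
    rw [covariance_const_mul_left, covariance_const_mul_right, covariance_const_mul_left,
      covariance_const_mul_right, real_inner_smul_left, real_inner_smul_right, ← covN]

/-! ### Sums of independent Gaussian processes on a product space. -/

section Product

variable {T Ω Ω' : Type*} [MeasurableSpace Ω] [MeasurableSpace Ω'] {P : Measure Ω}
  {P' : Measure Ω'} [IsProbabilityMeasure P] [IsProbabilityMeasure P']
  {X : T → Ω → ℝ} {Z : T → Ω' → ℝ}

theorem ProbabilityTheory.IsGaussianProcess.add_prod (hX : IsGaussianProcess X P) (hZ : IsGaussianProcess Z P') :
    IsGaussianProcess (fun t (p : Ω × Ω') => X t p.1 + Z t p.2) (P.prod P') := by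
  refine ⟨fun I => ?_⟩
  have gX := hX.hasGaussianLaw I
  have gZ := hZ.hasGaussianLaw I
  have h : HasGaussianLaw
      (fun p : Ω × Ω' => (I.restrict (X · p.1), I.restrict (Z · p.2))) (P.prod P') := by
    have h1 : HasGaussianLaw (fun p : Ω × Ω' => I.restrict (X · p.1)) (P.prod P') := by
      refine ⟨?_⟩
      have := gX.isGaussian_map
      rwa [← measurePreserving_fst.map_eq (μa := P.prod P') (μb := P),
        AEMeasurable.map_map_of_aemeasurable] at this
      · rw [measurePreserving_fst.map_eq]
        exact gX.aemeasurable
      · fun_prop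
    have h2 : HasGaussianLaw (fun p : Ω × Ω' => I.restrict (Z · p.2)) (P.prod P') := by
      refine ⟨?_⟩
      have := gZ.isGaussian_map
      rwa [← measurePreserving_snd.map_eq (μa := P.prod P') (μb := P'),
        AEMeasurable.map_map_of_aemeasurable] at this
      · rw [measurePreserving_snd.map_eq]
        exact gZ.aemeasurable
      · fun_prop
    exact IndepFun.hasGaussianLaw h1 h2 (indepFun_prod₀ gX.aemeasurable gZ.aemeasurable)
  exact h.fun_add

theorem covariance_add_prod (hX : IsGaussianProcess X P) (hZ : IsGaussianProcess Z P') (s t : T) :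
    cov[fun p : Ω × Ω' => X s p.1 + Z s p.2, fun p : Ω × Ω' => X t p.1 + Z t p.2; P.prod P'] =
      cov[X s, X t; P] + cov[Z s, Z t; P'] := by
  have mX : ∀ t, MemLp (X t) 2 P := fun t => (hX.hasGaussianLaw_eval t).memLp_two
  have mZ : ∀ t, MemLp (Z t) 2 P' := fun t => (hZ.hasGaussianLaw_eval t).memLp_two
  have mX' := fun t => (mX t).comp_fst P'
  have mZ' := fun t => (mZ t).comp_snd P
  have c1 : ∀ s t, cov[fun p : Ω × Ω' => X s p.1, fun p : Ω × Ω' => Z t p.2; P.prod P'] = 0 :=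
    fun s t => (indepFun_prod₀ (mX s).aemeasurable (mZ t).aemeasurable).covariance_eq_zero
      (mX' s) (mZ' t)
  have c2 : cov[fun p : Ω × Ω' => X s p.1, fun p : Ω × Ω' => X t p.1; P.prod P'] =
      cov[X s, X t; P] := by
    conv_rhs => rw [← measurePreserving_fst.map_eq (μa := P.prod P') (μb := P)]
    rw [covariance_map_fun _ _ measurable_fst.aemeasurable] <;>
    · rw [measurePreserving_fst.map_eq]
      exact (mX _).aestronglyMeasurable
  have c3 : cov[fun p : Ω × Ω' => Z s p.2, fun p : Ω × Ω' => Z t p.2; P.prod P'] =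
      cov[Z s, Z t; P'] := by
    conv_rhs => rw [← measurePreserving_snd.map_eq (μa := P.prod P') (μb := P')]
    rw [covariance_map_fun _ _ measurable_snd.aemeasurable] <;>
    · rw [measurePreserving_snd.map_eq]
      exact (mZ _).aestronglyMeasurable
  have a1 := covariance_add_left (mX' s) (mZ' s) ((mX' t).add (mZ' t))
  have a2 := covariance_add_right (mX' s) (mX' t) (mZ' t)
  have a3 := covariance_add_right (mZ' s) (mX' t) (mZ' t)
  refine a1.trans ?_
  rw [a2, a3, c2, c3, c1, covariance_comm (fun x : Ω × Ω' => Z s x.2), c1]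
  ring

end Product

/-! ### Spectral densities and their covariances as inner products in `L²`. -/

section Spectral

variable {d : ℕ} {f g : EuclideanSpace ℝ (Fin d) → ℝ}

@[simp]
theorem incrementKernel_zero_right (x : EuclideanSpace ℝ (Fin d)) : incrementKernel x 0 = 0 := by
  simp [incrementKernel]

theorem continuous_incrementKernel (x : EuclideanSpace ℝ (Fin d)) :
    Continuous (incrementKernel x) := by
  unfold incrementKernel
  fun_prop

theorem norm_incrementKernel_le (x ξ : EuclideanSpace ℝ (Fin d)) :
    ‖incrementKernel x ξ‖ ≤ max 2 ‖x‖ * min 1 ‖ξ‖ := by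
  have h1 : ‖incrementKernel x ξ‖ ≤ 2 := by
    refine (norm_sub_le _ _).trans ?_
    rw [Complex.norm_exp_I_mul_ofReal, norm_one]
    norm_num
  have h2 : ‖incrementKernel x ξ‖ ≤ ‖x‖ * ‖ξ‖ :=
    (Real.norm_exp_I_mul_ofReal_sub_one_le).trans (norm_inner_le_norm x ξ)
  rcases le_total 1 ‖ξ‖ with h | h
  · rw [min_eq_left h, mul_one]
    exact h1.trans (le_max_left _ _)
  · rw [min_eq_right h]
    exact h2.trans (by gcongr; exact le_max_right _ _)

theorem IsSpectralDensity.const_mul_sub (hf : IsSpectralDensity f) (hg : IsSpectralDensity g)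
    {C : ℝ} (hle : ∀ ξ, f ξ ≤ C * g ξ) : IsSpectralDensity fun ξ => C * g ξ - f ξ where
  nonneg ξ := sub_nonneg.2 (hle ξ)
  integrable := by
    refine ((hg.integrable.const_mul C).sub hf.integrable).congr (.of_forall fun ξ => ?_)
    simp only [Pi.sub_apply]
    ring

/-- The square root of a spectral density times the increment kernel, written so that its
measurability follows from that of `min 1 ‖ξ‖ ^ 2 * f ξ`. -/
noncomputable def spectralRoot (f : EuclideanSpace ℝ (Fin d) → ℝ)
    (x ξ : EuclideanSpace ℝ (Fin d)) : ℂ :=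
  incrementKernel x ξ * (((min 1 ‖ξ‖)⁻¹ * √(min 1 (‖ξ‖ ^ 2) * f ξ) : ℝ) : ℂ)

theorem min_one_norm_sq (ξ : EuclideanSpace ℝ (Fin d)) :
    min 1 (‖ξ‖ ^ 2) = min 1 ‖ξ‖ ^ 2 := by
  rcases le_total 1 ‖ξ‖ with h | h
  · rw [min_eq_left h, min_eq_left (one_le_pow₀ h), one_pow]
  · rw [min_eq_right h, min_eq_right (pow_le_one₀ (norm_nonneg _) h)]

theorem spectralRoot_mul_conj (hf : IsSpectralDensity f) (x x' ξ : EuclideanSpace ℝ (Fin d)) :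
    spectralRoot f x ξ * starRingEnd ℂ (spectralRoot f x' ξ) =
      incrementKernel x ξ * starRingEnd ℂ (incrementKernel x' ξ) * (f ξ : ℂ) := by
  -- At the origin `(min 1 ‖ξ‖)⁻¹` is `0` by convention; nothing is lost, since the kernel vanishes
  -- there.
  rcases eq_or_ne ξ 0 with rfl | hξ
  · simp [spectralRoot]
  have hm : min 1 ‖ξ‖ ≠ 0 := (lt_min one_pos (norm_pos_iff.2 hξ)).ne'
  have hs : ((min 1 ‖ξ‖)⁻¹ * √(min 1 (‖ξ‖ ^ 2) * f ξ)) *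
      ((min 1 ‖ξ‖)⁻¹ * √(min 1 (‖ξ‖ ^ 2) * f ξ)) = f ξ := by
    rw [mul_mul_mul_comm, Real.mul_self_sqrt (mul_nonneg (by positivity) (hf.nonneg ξ)),
      min_one_norm_sq]
    field_simp
  simp only [spectralRoot, map_mul, Complex.conj_ofReal]
  rw [mul_mul_mul_comm, ← Complex.ofReal_mul, hs]

theorem IsSpectralDensity.memLp_spectralRoot (hf : IsSpectralDensity f)
    (x : EuclideanSpace ℝ (Fin d)) : MemLp (spectralRoot f x) 2 := by
  have hsm : AEStronglyMeasurable (fun ξ => √(min 1 (‖ξ‖ ^ 2) * f ξ)) :=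
    Real.continuous_sqrt.comp_aestronglyMeasurable hf.integrable.aestronglyMeasurable
  have hs : MemLp (fun ξ => √(min 1 (‖ξ‖ ^ 2) * f ξ)) 2 := by
    rw [memLp_two_iff_integrable_sq hsm]
    refine hf.integrable.congr (.of_forall fun ξ => ?_)
    exact (Real.sq_sqrt (mul_nonneg (by positivity) (hf.nonneg ξ))).symm
  refine hs.of_le_mul (c := max 2 ‖x‖) ?_ (.of_forall fun ξ => ?_)
  · refine (continuous_incrementKernel x).aestronglyMeasurable.mul
      (Complex.continuous_ofReal.comp_aestronglyMeasurable (AEStronglyMeasurable.mul ?_ hsm))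
    exact Measurable.aestronglyMeasurable (by fun_prop)
  · have hm : 0 ≤ min 1 ‖ξ‖ := by positivity
    rw [spectralRoot, norm_mul, Complex.norm_real, norm_mul, norm_inv, Real.norm_of_nonneg hm,
      ← mul_assoc]
    gcongr
    refine mul_inv_le_of_le_mul₀ hm (by positivity) (norm_incrementKernel_le x ξ)

theorem IsSpectralDensity.integrable_incrementKernel (hf : IsSpectralDensity f)
    (x x' : EuclideanSpace ℝ (Fin d)) :
    Integrable fun ξ =>
      incrementKernel x ξ * starRingEnd ℂ (incrementKernel x' ξ) * (f ξ : ℂ) := by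
  simp only [← spectralRoot_mul_conj hf]
  exact (hf.memLp_spectralRoot x).integrable_mul (hf.memLp_spectralRoot x').star

/-- Presents the covariance as a Gram matrix, the form needed to construct a Gaussian sequence. The
real part appears because complex `L²` is used as a real Hilbert space. -/
theorem IsSpectralDensity.inner_toLp_spectralRoot (hf : IsSpectralDensity f)
    (x x' : EuclideanSpace ℝ (Fin d)) :
    ⟪(hf.memLp_spectralRoot x).toLp, (hf.memLp_spectralRoot x').toLp⟫ =
      (∫ ξ, incrementKernel x ξ * starRingEnd ℂ (incrementKernel x' ξ) * (f ξ : ℂ)).re := by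
  rw [L2.inner_def]
  have := integral_re (hf.integrable_incrementKernel x x')
  simp only [RCLike.re_to_complex] at this
  rw [← this]
  refine integral_congr_ae ?_
  filter_upwards [(hf.memLp_spectralRoot x).coeFn_toLp, (hf.memLp_spectralRoot x').coeFn_toLp]
    with ξ h h'
  rw [h, h', Complex.inner, ← spectralRoot_mul_conj hf]
  simp
  ring

end Spectral

/-! ### Splitting `√C Y` into independent summands. -/

section Gaussian

variable {d : ℕ} {Ω Ω' : Type*} [MeasurableSpace Ω] [MeasurableSpace Ω'] {P : Measure Ω}
  {P' : Measure Ω'} [IsProbabilityMeasure P] [IsProbabilityMeasure P']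
  {X : EuclideanSpace ℝ (Fin d) → Ω → ℝ} {Y : EuclideanSpace ℝ (Fin d) → Ω' → ℝ}
  {f g : EuclideanSpace ℝ (Fin d) → ℝ}

theorem IsGaussianFieldWithSpectralDensity.covariance_eq
    (hX : IsGaussianFieldWithSpectralDensity X P f) (x x' : EuclideanSpace ℝ (Fin d)) :
    cov[X x, X x'; P] =
      (∫ ξ, incrementKernel x ξ * starRingEnd ℂ (incrementKernel x' ξ) * (f ξ : ℂ)).re := by
  rw [covariance_eq_sub (hX.gaussian.hasGaussianLaw_eval x).memLp_two
    (hX.gaussian.hasGaussianLaw_eval x').memLp_two, ← hX.covariance, hX.centered]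
  simp

/-- If the spectral density of `X` is at most `C` times that of `Y`, then, on any sequence of
points, `√C Y` has the law of `X + Z` and of `X - Z`, for some `Z` independent of `X`. -/
theorem IsGaussianFieldWithSpectralDensity.exists_map_add_eq
    (hX : IsGaussianFieldWithSpectralDensity X P f)
    (hY : IsGaussianFieldWithSpectralDensity Y P' g) {C : ℝ} (hC : 0 ≤ C)
    (hle : ∀ ξ, f ξ ≤ C * g ξ) (t : ℕ → EuclideanSpace ℝ (Fin d)) :
    ∃ (Θ : Type) (_ : MeasurableSpace Θ) (Q : Measure Θ) (_ : IsProbabilityMeasure Q)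
      (Z : ℕ → Θ → ℝ), (∀ n, Measurable (Z n)) ∧
      (P.prod Q).map (fun p n => X (t n) p.1 + Z n p.2) = P'.map (fun ω n => √C * Y (t n) ω) ∧
      (P.prod Q).map (fun p n => X (t n) p.1 - Z n p.2) = P'.map (fun ω n => √C * Y (t n) ω) := by
  have hh := hX.density.const_mul_sub hY.density hle
  obtain ⟨Θ, mΘ, Q, hQ, Z, mZ, gZ, meanZ, covZ⟩ := exists_isGaussianProcess_covariance_eq_inner
    fun n => (hh.memLp_spectralRoot (t n)).toLp
  have gX : IsGaussianProcess (fun n => X (t n)) P := hX.gaussian.comp_right t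
  have gY : IsGaussianProcess (fun n ω => √C * Y (t n) ω) P' :=
    (hY.gaussian.comp_right t).smul fun _ => √C
  have gZ' : IsGaussianProcess (fun n η => -Z n η) Q := by
    simpa using gZ.smul fun _ => -1
  have covXZ : ∀ m n, cov[X (t m), X (t n); P] + cov[Z m, Z n; Q] =
      cov[fun ω => √C * Y (t m) ω, fun ω => √C * Y (t n) ω; P'] := by
    intro m n
    rw [covariance_const_mul_left, covariance_const_mul_right, ← mul_assoc,
      Real.mul_self_sqrt hC, covZ, hh.inner_toLp_spectralRoot, hX.covariance_eq,
      hY.covariance_eq]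
    have hsub : ∫ ξ, incrementKernel (t m) ξ * starRingEnd ℂ (incrementKernel (t n) ξ) *
          ((C * g ξ - f ξ : ℝ) : ℂ) =
        C * (∫ ξ, incrementKernel (t m) ξ * starRingEnd ℂ (incrementKernel (t n) ξ) * (g ξ : ℂ)) -
          ∫ ξ, incrementKernel (t m) ξ * starRingEnd ℂ (incrementKernel (t n) ξ) * (f ξ : ℂ) := by
      rw [← integral_const_mul, ← integral_sub
        ((hY.density.integrable_incrementKernel _ _).const_mul _)
        (hX.density.integrable_incrementKernel _ _)]
      refine integral_congr_ae (.of_forall fun ξ => ?_)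
      push_cast
      ring
    rw [hsub]
    simp
  have iX : ∀ n, Integrable (X (t n)) P := fun n => (gX.hasGaussianLaw_eval n).integrable
  have iZ : ∀ n, Integrable (Z n) Q := fun n => (gZ.hasGaussianLaw_eval n).integrable
  have iZ' : ∀ n, Integrable (fun η => -Z n η) Q := fun n => (iZ n).neg
  refine ⟨Θ, mΘ, Q, hQ, Z, mZ, ?_, ?_⟩
  · refine (gX.add_prod gZ).map_eq_of_covariance_eq gY (fun n => ?_) fun m n => ?_
    · rw [integral_add ((iX n).comp_fst _) ((iZ n).comp_snd _), integral_const_mul, hY.centered,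
        integral_fun_fst (X (t n)), integral_fun_snd (Z n), hX.centered, meanZ]
      simp
    · rw [covariance_add_prod gX gZ, covXZ]
  -- `-Z` is centered Gaussian with the same covariance as `Z`.
  · simp only [sub_eq_add_neg]
    refine (gX.add_prod gZ').map_eq_of_covariance_eq gY (fun n => ?_) fun m n => ?_
    · rw [integral_add ((iX n).comp_fst _) ((iZ' n).comp_snd _), integral_const_mul,
        hY.centered, integral_fun_fst (X (t n)), integral_fun_snd (fun η => -Z n η), integral_neg,
        hX.centered, meanZ]
      simp
    · rw [covariance_add_prod gX gZ', covariance_fun_neg_left, covariance_fun_neg_right, neg_neg,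
        covXZ]

end Gaussian

/-! ### Membership of paths in a subspace, read along a dense sequence. -/

section Paths

/-- Values along a dense sequence, as an injection of `C(K, ℝ)` into `ℝ^ℕ`, send Borel sets to
measurable sets. -/
theorem measurableSet_image_eval_denseRange {K : Type*} [TopologicalSpace K] [CompactSpace K]
    [SecondCountableTopology K] [LocallyCompactSpace K] {t : ℕ → K} (ht : DenseRange t)
    {S : Set C(K, ℝ)} (hS : MeasurableSet[borel C(K, ℝ)] S) :
    MeasurableSet ((fun (g : C(K, ℝ)) n => g (t n)) '' S) := by
  borelize C(K, ℝ)
  -- Lusin–Souslin: `C(K, ℝ)` is Polish and evaluation is continuous and injective.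
  refine hS.image_of_continuousOn_injOn (Continuous.continuousOn ?_) (fun g _ h _ e => ?_)
  · fun_prop
  · exact DFunLike.coe_injective (ht.equalizer g.continuous h.continuous e)

variable {E Ω Ω' : Type*} [MeasurableSpace Ω] [MeasurableSpace Ω'] {P : Measure Ω}
  {P' : Measure Ω'} [TopologicalSpace E] {K : Set E}

theorem measurableSet_borel_affine_image [LocallyCompactSpace K] {S : Set C(K, ℝ)}
    (hS : MeasurableSet[borel C(K, ℝ)] S) {c : ℝ} (hc : c ≠ 0) (b : C(K, ℝ)) :
    MeasurableSet[borel C(K, ℝ)] ((fun g => c • g - b) '' S) := by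
  borelize C(K, ℝ)
  have : (fun g : C(K, ℝ) => c • g - b) '' S = (fun g => c⁻¹ • (g + b)) ⁻¹' S := by
    ext g
    constructor
    · rintro ⟨g, hg, rfl⟩
      simpa [← smul_add, hc] using hg
    · intro hg
      exact ⟨_, hg, by simp [hc]⟩
  rw [this]
  exact (by fun_prop : Continuous fun g : C(K, ℝ) => c⁻¹ • (g + b)).measurable hS

/-- If `X ± Z`, with `Z` independent of `X`, both have along a dense sequence the law of a process
with paths in a linear subspace, then so has `X`. -/
theorem exists_ae_mem_of_map_add_eq [CompactSpace K] [SecondCountableTopology K]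
    [LocallyCompactSpace K] [IsProbabilityMeasure P]
    {Θ : Type*} [MeasurableSpace Θ] {Q : Measure Θ} [IsProbabilityMeasure Q]
    {t : ℕ → K} (ht : DenseRange t) {X : ℕ → Ω → ℝ} (hX : ∀ n, AEMeasurable (X n) P)
    {Z : ℕ → Θ → ℝ} (hZ : ∀ n, Measurable (Z n)) {Y : ℕ → Ω' → ℝ}
    (hY : ∀ n, AEMeasurable (Y n) P') {c : ℝ} (hc : c ≠ 0)
    (hadd : (P.prod Q).map (fun p n => X n p.1 + Z n p.2) = P'.map (fun ω n => c * Y n ω))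
    (hsub : (P.prod Q).map (fun p n => X n p.1 - Z n p.2) = P'.map (fun ω n => c * Y n ω))
    (V : Submodule ℝ C(K, ℝ)) {S : Set C(K, ℝ)} (hS : MeasurableSet[borel C(K, ℝ)] S)
    (hSV : S ⊆ V) (hYS : ∀ᵐ ω ∂P', ∃ g ∈ S, ∀ n, Y n ω = g (t n)) :
    ∃ S' : Set C(K, ℝ), MeasurableSet[borel C(K, ℝ)] S' ∧ S' ⊆ V ∧
      ∀ᵐ ω ∂P, ∃ g ∈ S', ∀ n, X n ω = g (t n) := by
  have hcS : MeasurableSet[borel C(K, ℝ)] ((fun g => c • g - 0) '' S) :=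
    measurableSet_borel_affine_image hS hc 0
  have hT := measurableSet_image_eval_denseRange ht hcS
  set T := (fun (g : C(K, ℝ)) n => g (t n)) '' ((fun g => c • g - 0) '' S)
  have mcY : AEMeasurable (fun ω n => c * Y n ω) P' :=
    aemeasurable_pi_lambda _ fun n => (hY n).const_mul c
  have hYT : ∀ᵐ x ∂P'.map (fun ω n => c * Y n ω),
      x ∈ T := by
    rw [ae_map_iff (p := (· ∈ T)) mcY hT]
    filter_upwards [hYS] with ω ⟨g, hg, h⟩
    exact ⟨_, ⟨g, hg, rfl⟩, by simp [h]⟩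
  have mX1 : ∀ n, AEMeasurable (fun p : Ω × Θ => X n p.1) (P.prod Q) := fun n => (hX n).comp_fst
  have mZ2 : ∀ n, AEMeasurable (fun p : Ω × Θ => Z n p.2) (P.prod Q) := fun n =>
    ((hZ n).comp measurable_snd).aemeasurable
  have mAdd : AEMeasurable (fun (p : Ω × Θ) n => X n p.1 + Z n p.2) (P.prod Q) :=
    aemeasurable_pi_lambda _ fun n => (mX1 n).add (mZ2 n)
  have mSub : AEMeasurable (fun (p : Ω × Θ) n => X n p.1 - Z n p.2) (P.prod Q) :=
    aemeasurable_pi_lambda _ fun n => (mX1 n).sub (mZ2 n)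
  have h1 := hYT
  rw [← hadd, ae_map_iff (p := (· ∈ T)) mAdd hT] at h1
  have h2 := hYT
  rw [← hsub, ae_map_iff (p := (· ∈ T)) mSub hT] at h2
  -- The swap puts `Θ` outermost, so that Fubini fixes `η` and leaves `X` random.
  have h3 := Measure.measurePreserving_swap.quasiMeasurePreserving.ae (h1.and h2)
  obtain ⟨η, hη⟩ := (Measure.ae_ae_of_ae_prod h3).exists
  -- A single `ω` is enough to identify the deterministic path `Z · η` with an element of `V`.
  obtain ⟨ω, ⟨-, ⟨g₁, hg₁, rfl⟩, e₁⟩, -, ⟨g₂, hg₂, rfl⟩, e₂⟩ := hη.exists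
  simp only [funext_iff, ContinuousMap.smul_apply, smul_eq_mul, sub_zero, Prod.swap] at e₁ e₂
  have hZη : ∀ n, Z n η = ((2 : ℝ)⁻¹ • (c • g₁ - c • g₂)) (t n) := fun n => by
    simp only [ContinuousMap.sub_apply, ContinuousMap.smul_apply, smul_eq_mul]
    linarith [e₁ n, e₂ n]
  have hbV : (2 : ℝ)⁻¹ • (c • g₁ - c • g₂) ∈ V :=
    V.smul_mem _ (V.sub_mem (V.smul_mem _ (hSV hg₁)) (V.smul_mem _ (hSV hg₂)))
  refine ⟨_, measurableSet_borel_affine_image hS hc ((2 : ℝ)⁻¹ • (c • g₁ - c • g₂)), ?_, ?_⟩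
  · rintro _ ⟨g, hg, rfl⟩
    exact V.sub_mem (V.smul_mem _ (hSV hg)) hbV
  · filter_upwards [hη] with ω hω
    obtain ⟨⟨-, ⟨g, hg, rfl⟩, e⟩, -⟩ := hω
    refine ⟨_, ⟨g, hg, rfl⟩, fun n => ?_⟩
    have := congrFun e n
    simp only [ContinuousMap.smul_apply, smul_eq_mul, sub_zero, Prod.swap] at this
    rw [ContinuousMap.sub_apply, ← hZη, ContinuousMap.smul_apply, smul_eq_mul]
    linarith

theorem IsGaussianFieldWithSpectralDensity.exists_ae_mem_of_le {d : ℕ}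
    [IsProbabilityMeasure P] [IsProbabilityMeasure P']
    {X : EuclideanSpace ℝ (Fin d) → Ω → ℝ} {Y Y' : EuclideanSpace ℝ (Fin d) → Ω' → ℝ}
    {f g : EuclideanSpace ℝ (Fin d) → ℝ}
    (hX : IsGaussianFieldWithSpectralDensity X P f)
    (hY : IsGaussianFieldWithSpectralDensity Y P' g) {C : ℝ} (hC : 0 < C)
    (hle : ∀ ξ, f ξ ≤ C * g ξ) {K : Set (EuclideanSpace ℝ (Fin d))} (hK : IsCompact K)
    (V : Submodule ℝ C(K, ℝ)) (hv : IsVersionOf P' Y' Y) (hY' : SamplePathsIn P' Y' K V)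
    {t : ℕ → K} (ht : DenseRange t) :
    ∃ S : Set C(K, ℝ), MeasurableSet[borel C(K, ℝ)] S ∧ S ⊆ V ∧
      ∀ᵐ ω ∂P, ∃ g ∈ S, ∀ n, X (t n) ω = g (t n) := by
  have : CompactSpace K := isCompact_iff_compactSpace.mp hK
  obtain ⟨S, hS, hSV, hYS⟩ := hY'
  obtain ⟨Θ, mΘ, Q, hQ, Z, mZ, hadd, hsub⟩ :=
    hX.exists_map_add_eq hY hC.le hle fun n => (t n : EuclideanSpace ℝ (Fin d))
  refine exists_ae_mem_of_map_add_eq ht (fun n => hX.gaussian.aemeasurable _) mZ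
    (fun n => hY.gaussian.aemeasurable _) (Real.sqrt_pos.2 hC).ne' hadd hsub V hS hSV ?_
  filter_upwards [hYS, ae_all_iff.2 fun n => hv (t n)] with ω ⟨g, hg, h⟩ hω
  exact ⟨g, hg, fun n => by rw [← hω n, h]⟩

end Paths

/-! ### From a dense sequence to versions on `K`. -/

section Versions

variable {E Ω : Type*} [TopologicalSpace E] [MeasurableSpace Ω] {P : Measure Ω}
  {X X' : E → Ω → ℝ} {K : Set E} {A : Set C(K, ℝ)}

theorem exists_version_samplePathsIn
    (h : ∀ t : ℕ → K, DenseRange t → ∃ S : Set C(K, ℝ), MeasurableSet[borel C(K, ℝ)] S ∧ S ⊆ A ∧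
      ∀ᵐ ω ∂P, ∃ g ∈ S, ∀ n, X (t n) ω = g (t n)) {t : ℕ → K} (ht : DenseRange t) :
    ∃ X', IsVersionOf P X' X ∧ SamplePathsIn P X' K A := by
  classical
  obtain ⟨S, hS, hSA, hXS⟩ := h t ht
  let X' : E → Ω → ℝ := fun x ω =>
    if hx : x ∈ K then
      if hω : ∃ g ∈ S, ∀ n, X (t n) ω = g (t n) then hω.choose ⟨x, hx⟩ else X x ω
    else X x ω
  have hX' : ∀ ω (hω : ∃ g ∈ S, ∀ n, X (t n) ω = g (t n)) (x : K), X' x ω = hω.choose x := by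
    intro ω hω x
    simp only [X', dif_pos hω, dif_pos x.2]
  refine ⟨X', fun x => ?_, S, hS, hSA, ?_⟩
  · by_cases hx : x ∈ K
    -- With `x` prepended, the continuous function matching `X` along `s` is the one chosen along
    -- `t`, by density, and at index `0` it equals `X x`.
    · let s : ℕ → K := fun n => n.casesOn ⟨x, hx⟩ t
      have hs : DenseRange s := ht.mono (by rintro _ ⟨n, rfl⟩; exact ⟨n + 1, rfl⟩)
      obtain ⟨_, _, _, hXs⟩ := h s hs
      filter_upwards [hXS, hXs] with ω hω hω'
      obtain ⟨g, -, hg⟩ := hω'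
      have : ⇑hω.choose = g := ht.equalizer hω.choose.continuous g.continuous
        (funext fun n => (hω.choose_spec.2 n).symm.trans (hg (n + 1)))
      rw [hX' ω hω ⟨x, hx⟩, this]
      exact (hg 0).symm
    · exact .of_forall fun ω => by simp only [X', dif_neg hx]
  · filter_upwards [hXS] with ω hω
    exact ⟨_, hω.choose_spec.1, hX' ω hω⟩

theorem IsVersionOf.samplePathsIn_of_continuousOn (hv : IsVersionOf P X' X)
    (hc : ∀ᵐ ω ∂P, ContinuousOn (fun x => X' x ω) K) {t : ℕ → K} (ht : DenseRange t)
    {S : Set C(K, ℝ)} (hS : MeasurableSet[borel C(K, ℝ)] S) (hSA : S ⊆ A)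
    (hXS : ∀ᵐ ω ∂P, ∃ g ∈ S, ∀ n, X (t n) ω = g (t n)) : SamplePathsIn P X' K A := by
  refine ⟨S, hS, hSA, ?_⟩
  filter_upwards [hXS, hc, ae_all_iff.2 fun n => hv (t n)] with ω ⟨g, hg, h⟩ hcω hvω
  exact ⟨g, hg, congrFun (ht.equalizer hcω.domRestrict g.continuous
    (funext fun n => (hvω n).trans (h n)))⟩

theorem samplePathsIn_of_isEmpty [IsEmpty K] (hA : A.Nonempty) (X : E → Ω → ℝ) :
    SamplePathsIn P X K A := by
  obtain ⟨a, ha⟩ := hA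
  borelize C(K, ℝ)
  refine ⟨{a}, ?_, by simpa using ha, .of_forall fun ω => ⟨a, rfl, fun x => isEmptyElim x⟩⟩
  exact measurableSet_singleton a

end Versions

theorem theorem1 {d : ℕ}
    {Ω : Type*} [MeasurableSpace Ω] (P : Measure Ω) [IsProbabilityMeasure P]
    {Ω' : Type*} [MeasurableSpace Ω'] (P' : Measure Ω') [IsProbabilityMeasure P']
    (X : EuclideanSpace ℝ (Fin d) → Ω → ℝ) (Y : EuclideanSpace ℝ (Fin d) → Ω' → ℝ)
    (fX fY : EuclideanSpace ℝ (Fin d) → ℝ)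
    (hX : IsGaussianFieldWithSpectralDensity X P fX)
    (hY : IsGaussianFieldWithSpectralDensity Y P' fY)
    (K : Set (EuclideanSpace ℝ (Fin d))) (hK : IsCompact K)
    (B : Type*) [NormedAddCommGroup B] [NormedSpace ℝ B]
    (hB : (CompleteSpace B ∧ TopologicalSpace.SeparableSpace B) ∨ IsDualOfSeparable B)
    (ι : B →L[ℝ] C(K, ℝ)) (hι : Function.Injective ι)
    (C : ℝ) (hC : 0 < C) (hle : ∀ ξ, fX ξ ≤ C * fY ξ)
    (hYB : ∃ Y', IsVersionOf P' Y' Y ∧ SamplePathsIn P' Y' K (Set.range ι)) :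
    (∃ X', IsVersionOf P X' X ∧ SamplePathsIn P X' K (Set.range ι)) ∧
      ∀ X', IsVersionOf P X' X → (∀ᵐ ω ∂P, ContinuousOn (fun x => X' x ω) K) →
        SamplePathsIn P X' K (Set.range ι) := by
  obtain ⟨Y', hv, hY'⟩ := hYB
  -- An empty `K` carries no sequence, so it is treated apart.
  rcases isEmpty_or_nonempty K with hE | hN
  · exact ⟨⟨X, fun _ => .rfl, samplePathsIn_of_isEmpty (Set.range_nonempty ι) X⟩,
      fun X' _ _ => samplePathsIn_of_isEmpty (Set.range_nonempty ι) X'⟩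
  have h : ∀ t : ℕ → K, DenseRange t → ∃ S : Set C(K, ℝ),
      MeasurableSet[borel C(K, ℝ)] S ∧ S ⊆ Set.range ι ∧
        ∀ᵐ ω ∂P, ∃ g ∈ S, ∀ n, X (t n) ω = g (t n) := fun t ht =>
    hX.exists_ae_mem_of_le hY hC hle hK (LinearMap.range (ι : B →ₗ[ℝ] C(K, ℝ))) hv hY' ht
  have ht := TopologicalSpace.denseRange_denseSeq K
  refine ⟨exists_version_samplePathsIn h ht, fun X' hX' hc => ?_⟩
  obtain ⟨S, hS, hSA, hXS⟩ := h _ ht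
  exact hX'.samplePathsIn_of_continuousOn hc ht hS hSA hXS
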